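/- All maps are smooth and $S^1=\mathbb R/2\pi\mathbb Z$; functions on $S^1$ are identified with $2\pi$-periodic functions of $s\in\mathbb R$, and $D_s=\partial/\partial s$. Let $\mathcal M$ be the space of closed equicentroaffine plane curves, i.e. of maps $\gamma:S^1\to\mathbb R^2\setminus\{0\}$ with $\det\begin{pmatrix}\gamma\\ \gamma_s\end{pmatrix}=1$, and let $\kappa$, defined by $\gamma_{ss}=-\kappa\gamma$, be the equicentroaffine curvature of $\gamma$. Let $H_m:\mathcal M\to\mathbb R$ $(m=1,2,\dots)$ be the KdV Hamiltonians $H_m(\gamma)=\int_{S^1}h_m(\kappa,\kappa_s,\kappa_{ss},\dots)\,ds$, where $h_m=\frac1{2m-1}g_m$ and the differential polynomials $g_n$ in $\kappa$ are given by $g_0=1$ and $$g_{n+1}=\sum_{i+j=n}\Big(\tfrac12 g_i D_s^2g_j-\tfrac14 (D_sg_i)(D_sg_j)+\kappa g_ig_j\Big)-\tfrac12\sum_{\substack{i+j=n+1\\ i,j\ge1}}g_ig_j .$$ (Equivalently, $D_sg_{n+1}=(\frac12D_s^3+2\kappa D_s+\kappa_s)g_n$ with zero constants of integration, and $\delta H_m/\delta\kappa=g_{m-1}$;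 up to total derivatives $h_1=\kappa$, $h_2=\frac12\kappa^2$, $h_3=\frac12\kappa^3-\frac14\kappa_s^2$.) For real numbers $c_1,c_2,\dots$ and $m\ge1$ put $\mathcal M(C_m)=H_1^{-1}(c_1)\cap\dots\cap H_m^{-1}(c_m)$. For $\gamma\in\mathcal M(C_m)$ let $T_\gamma\mathcal M(C_m)$ be the common kernel of $dH_1,\dots,dH_m$ at $\gamma$: the set of velocities $X=\gamma_t|_{t=0}$ of smooth one-parameter families $\gamma(\cdot,t)\in\mathcal M$ with $\gamma(\cdot,0)=\gamma$ along which $\frac{d}{dt}\big|_{t=0}H_k(\gamma(\cdot,t))=0$ for $k=1,\dots,m$. Let $\Omega=\frac12D_s^2+2\kappa+\kappa_sD_s^{-1}$. For $\alpha:S^1\to\mathbb R$ put $\Omega\alpha_s=\frac12\alpha_{sss}+2\kappa\alpha_s+\kappa_s\alpha$ (that is, $D_s^{-1}\alpha_s=\alpha$); for $k\ge1$, $\Omega^{k+1}\alpha_s=\frac12D_s^2f+2\kappa f+\kappa_sp$, where $f=\Omega^k\alpha_s$ and $p$ is a function on $S^1$ with $p_s=f$, provided that such a $p$ exists; the constant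 of integration in $p$ is arbitrary. **Proposition.** Let $m\ge1$, $\gamma\in\mathcal M(C_m)$, and let $\alpha:S^1\to\mathbb R$ be such that $X=-\frac12\alpha_s\gamma+\alpha\gamma_s\in T_\gamma\mathcal M(C_m)$. Then $\Omega\alpha_s,\Omega^2\alpha_s,\dots,\Omega^{m+1}\alpha_s$ are defined as smooth functions on $S^1$; more precisely, whatever constants of integration are chosen, for each $k=1,\dots,m$ the function $\Omega^k\alpha_s$ has a primitive on $S^1$, so that $\Omega^{k+1}\alpha_s$ can be formed. Moreover, for every such choice, $$\int_{S^1}\Omega^k\alpha_s\,ds=0\qquad(k=1,\dots,m).$$ -/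

import Mathlib

open scoped ContDiff

namespace CentroAffine

/-- Smooth real functions on `S¹ = ℝ / 2πℤ`, regarded as smooth `2π`-periodic functions on `ℝ`. -/
structure IsCircleFun (f : ℝ → ℝ) : Prop where
  smooth : ContDiff ℝ ∞ f
  periodic : Function.Periodic f (2 * Real.pi)

/-- The determinant of the `2 × 2` matrix with rows `v` and `w`. -/
noncomputable def det₂ (v w : Fin 2 → ℝ) : ℝ := (Matrix.of ![v, w]).det

/-- The space of closed equicentroaffine plane curves: smooth maps `γ : S¹ → ℝ² \ {0}` with
`det (γ, γ_s) = 1`. -/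
structure IsCurve (γ : ℝ → Fin 2 → ℝ) : Prop where
  smooth : ContDiff ℝ ∞ γ
  periodic : Function.Periodic γ (2 * Real.pi)
  ne_zero : ∀ s, γ s ≠ 0
  det_eq_one : ∀ s, det₂ (γ s) (deriv γ s) = 1

/-- The equicentroaffine curvature. For a curve with `det (γ, γ_s) = 1` it is the function `κ`
with `γ_ss = -κ γ`, see `deriv_deriv_eq` below. -/
noncomputable def curvature (γ : ℝ → Fin 2 → ℝ) (s : ℝ) : ℝ :=
  det₂ (deriv γ s) (deriv (deriv γ) s)

theorem deriv_deriv_eq {γ : ℝ → Fin 2 → ℝ} (hγ : IsCurve γ) (s : ℝ) :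
    deriv (deriv γ) s = -(curvature γ s) • γ s := by
  have h1 : HasDerivAt γ (deriv γ s) s :=
    (hγ.smooth.differentiable (by simp) s).hasDerivAt
  have hs : ContDiff ℝ ∞ (deriv γ) := by
    have := hγ.smooth
    exact (contDiff_infty_iff_deriv.1 this).2
  have h2 : HasDerivAt (deriv γ) (deriv (deriv γ) s) s :=
    (hs.differentiable (by simp) s).hasDerivAt
  have e : ∀ t, γ t 0 * deriv γ t 1 - γ t 1 * deriv γ t 0 = 1 := by
    intro t
    have := hγ.det_eq_one t
    simpa [det₂, Matrix.det_fin_two] using this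
  have a := hasDerivAt_pi.1 h1
  have b := hasDerivAt_pi.1 h2
  have d := ((a 0).mul (b 1)).sub ((a 1).mul (b 0))
  have d' : HasDerivAt (fun _ : ℝ => (1 : ℝ)) _ s :=
    d.congr_of_eventuallyEq (Filter.Eventually.of_forall fun t => (e t).symm)
  have z := d'.unique (hasDerivAt_const s (1 : ℝ))
  have es := e s
  ext i
  fin_cases i <;> simp [curvature, det₂, Matrix.det_fin_two]
  · linear_combination (-deriv (deriv γ) s 0) * es + deriv γ s 0 * z
  · linear_combination (-deriv (deriv γ) s 1) * es + deriv γ s 1 * z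

/-! ### The KdV Hamiltonians -/

/-- Differential polynomials in one function `κ`; the variable `X i` stands for the `i`-th
derivative `D_s^i κ`. -/
abbrev DiffPoly : Type := MvPolynomial ℕ ℝ

namespace DiffPoly

/-- The total derivative `D_s`: the derivation with `D_s (D_s^i κ) = D_s^(i+1) κ`. -/
noncomputable def D : Derivation ℝ DiffPoly DiffPoly :=
  MvPolynomial.mkDerivation ℝ fun i => MvPolynomial.X (i + 1)

/-- The value of a differential polynomial on the function `κ`, at the point `s`. -/
noncomputable def evalAt (κ : ℝ → ℝ) (s : ℝ) (p : DiffPoly) : ℝ :=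
  MvPolynomial.aeval (fun i => iteratedDeriv i κ s) p

/-- The gradients `g₀ = 1, g₁ = κ, g₂ = κ_ss / 2 + 3 κ² / 2, …` of the KdV hierarchy.

They are the solution, with zero constants of integration, of the Lenard recursion
`D_s g_{n+1} = Ω D_s g_n = (D_s³ / 2 + 2 κ D_s + κ_s) g_n`, so that `D_s g_{n+1} = Ωⁿ κ_s`.
For `G = ∑ g_n λ⁻ⁿ` this recursion says `(D_s³ / 2 + 2 κ D_s + κ_s) G = λ D_s G`; multiplying by
`G` and integrating once gives
`(G D_s² G) / 2 - (D_s G)² / 4 + κ G² - λ G² / 2 = -λ / 2`, and the definition is the coefficient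
of `λ⁻ⁿ` in this identity, solved for `g_{n+1}`. -/
noncomputable def grad : ℕ → DiffPoly
  | 0 => 1
  | n + 1 =>
    (∑ i : Fin (n + 1),
      (MvPolynomial.C (1 / 2) * grad i * D (D (grad (n - i)))
        - MvPolynomial.C (1 / 4) * D (grad i) * D (grad (n - i))
        + MvPolynomial.X 0 * grad i * grad (n - i)))
    - MvPolynomial.C (1 / 2) * ∑ i : Fin n, grad (i + 1) * grad (n - i)
  termination_by n => n
  decreasing_by all_goals omega

/-- The density `h_m` (`m ≥ 1`) of the `m`-th KdV Hamiltonian, normalized so that the variational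
derivative of `∫ h_m ds` is `g_{m-1}`; thus the `n`-th KdV equation `κ_t = Ωⁿ κ_s` is
`κ_t = D_s (δH_{n+2} / δκ)`. Since the variational derivative of `∫ g_m ds` is
`(2 m - 1) g_{m-1}`, the density is `g_m / (2 m - 1)`. Up to total derivatives,
`h₁ = κ`, `h₂ = κ² / 2`, `h₃ = κ³ / 2 - κ_s² / 4`. -/
noncomputable def density (m : ℕ) : DiffPoly :=
  MvPolynomial.C (1 / (2 * (m : ℝ) - 1)) * grad m

end DiffPoly

/-- The KdV Hamiltonian `H_m = ∫_{S¹} h_m(κ, κ_s, κ_ss, …) ds`, as a function of the curve. -/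
noncomputable def H (m : ℕ) (γ : ℝ → Fin 2 → ℝ) : ℝ :=
  ∫ s in (0 : ℝ)..(2 * Real.pi), DiffPoly.evalAt (curvature γ) s (DiffPoly.density m)

/-- The joint level set `M(C_m) = H_1⁻¹(c_1) ∩ … ∩ H_m⁻¹(c_m)` in the space of closed
equicentroaffine curves. -/
def levelSet (c : ℕ → ℝ) (m : ℕ) : Set (ℝ → Fin 2 → ℝ) :=
  {γ | IsCurve γ ∧ ∀ k, 1 ≤ k → k ≤ m → H k γ = c k}

/-- `Γ` is a smooth one-parameter family of closed equicentroaffine curves that starts at `γ` with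
velocity `X`, i.e. `Γ 0 = γ` and `∂Γ/∂t = X` at `t = 0`. -/
structure IsMotion (γ X : ℝ → Fin 2 → ℝ) (Γ : ℝ → ℝ → Fin 2 → ℝ) : Prop where
  smooth : ContDiff ℝ ∞ (fun p : ℝ × ℝ => Γ p.1 p.2)
  isCurve : ∀ t, IsCurve (Γ t)
  start : Γ 0 = γ
  velocity : ∀ s, deriv (fun t => Γ t s) 0 = X s

/-- The tangent space of `M(C_m)` at `γ`: the intersection of the kernels of the differentials
`dH_1, …, dH_m` at `γ`, that is, the velocities `X` of smooth motions of closed equicentroaffine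
curves starting at `γ` along which the derivative of each of `H_1, …, H_m` at time `0` is `0`.
(The motion need not stay in `M(C_m)`.) -/
def tangentSpace (m : ℕ) (γ : ℝ → Fin 2 → ℝ) : Set (ℝ → Fin 2 → ℝ) :=
  {X | ∃ Γ, IsMotion γ X Γ ∧
    ∀ k, 1 ≤ k → k ≤ m → HasDerivAt (fun t => H k (Γ t)) 0 0}

/-- The field `-½ α_s γ + α γ_s` along `γ`. -/
noncomputable def fieldOf (γ : ℝ → Fin 2 → ℝ) (α : ℝ → ℝ) (s : ℝ) : Fin 2 → ℝ :=
  (-(1 / 2) * deriv α s) • γ s + α s • deriv γ s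

/-! ### The recursion operator -/

/-- `½ D_s² f + 2 κ f + κ_s p`: the value of the recursion operator
`Ω = ½ D_s² + 2 κ + κ_s D_s⁻¹` on `f`, when `p` is taken for `D_s⁻¹ f`. -/
noncomputable def omega (κ f p : ℝ → ℝ) (s : ℝ) : ℝ :=
  1 / 2 * deriv (deriv f) s + 2 * κ s * f s + deriv κ s * p s

/-- `IsOmegaPower κ α k f`: the function `f` is a value of `Ω^k α_s`, where `k ≥ 1`.
The first step uses `D_s⁻¹ α_s = α`, so `Ω α_s = ½ α_sss + 2 κ α_s + κ_s α`. Each further step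
needs a primitive of `Ω^k α_s` that is a function on `S¹`; every choice of the constant of
integration is admitted. -/
inductive IsOmegaPower (κ α : ℝ → ℝ) : ℕ → (ℝ → ℝ) → Prop
  | one : IsOmegaPower κ α 1 (omega κ (deriv α) α)
  | succ {k : ℕ} {f p : ℝ → ℝ} (hf : IsOmegaPower κ α k f) (hp : IsCircleFun p)
      (hpf : deriv p = f) : IsOmegaPower κ α (k + 1) (omega κ f p)

end CentroAffine

namespace CentroAffine

/-! ### The resolvent equation in a differential ring -/

/-! Along a motion with velocity `-½ α_s γ + α γ_s` the curvature moves by `κ_t = Ω α_s`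
(`IsMotion.deriv_curvature`). Since `δH_{j+1}/δκ = g_j` (`hasDerivAt_integral_density`), tangency
says `∫ g_j Ω α_s = 0` for `j < m`. The operator `P = ½ D_s³ + 2 κ D_s + κ_s` is skew-adjoint and `P
g_j = D_s g_{j+1}`, so for any periodic `p` with `p_s = f` one gets `∫ g_j Ω f = ∫ g_j P p = -∫ (D_s
g_{j+1}) p = ∫ g_{j+1} f` (`integral_grad_mul_omega`). Iterating, `∫ g_j Ω^k α_s = ∫ g_{j+k-1} Ω α_s
= 0` whenever `j + k ≤ m`. The case `j = 0`, `g_0 = 1` gives mean zero, hence a periodic primitive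
and the next power. The constant in `p` never matters.

The algebraic input, the Lenard recursion and the variational derivative of `g_{n+1}`, has to be
extracted from the quadratic definition of `g_n`. Both follow from one equation for the generating
series `G = ∑ g_n zⁿ` with `z = λ⁻¹`: differentiating it along `D_s` gives the recursion
(`resolvent_lenard`), and comparing its derivatives along a variation `δ` and along `z` gives the
variational derivative (`resolvent_variation`). -/

theorem _root_.Derivation.map_ofNat_eq_zero {A : Type*} [CommRing A] [Algebra ℝ A]
    (D : Derivation ℝ A A) (n : ℕ) [n.AtLeastTwo] : D (OfNat.ofNat n) = 0 := by
  rw [← Nat.cast_ofNat (R := A)]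
  exact D.map_natCast n

section Resolvent

variable {A : Type*} [CommRing A] [Algebra ℝ A]

/-- A unit `G` with `z (2 G G'' - G'² + 4 K G²) = 2 G² - 2` satisfies the linear third order
equation of the Lenard recursion. -/
theorem resolvent_lenard (D : Derivation ℝ A A) {z K G : A} (hG : IsUnit G) (hz : D z = 0)
    (h : z * (2 * G * D (D G) - D G ^ 2 + 4 * K * G ^ 2) = 2 * G ^ 2 - 2) :
    2 * D G = z * (D (D (D G)) + 4 * K * D G + 2 * D K * G) := by
  have two : ∀ a : A, (2 : A) * a = 0 → a = 0 := fun a ha => by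
    have : (2 : ℝ) • a = 0 := by rw [← ha, ← map_ofNat (algebraMap ℝ A) 2, Algebra.smul_def]
    simpa using this
  have h' := congrArg D h
  simp only [D.leibniz, D.leibniz_pow, map_add, map_sub, D.map_ofNat_eq_zero, hz, smul_eq_mul, nsmul_eq_mul] at h'
  -- The terms `G' G''` cancel in the differentiated equation, and what remains is `2 G` times the
  -- claim.
  refine sub_eq_zero.1 (two _ (hG.mul_left_cancel (?_ : G * _ = G * 0)))
  push_cast at h'
  linear_combination -h'

/-- The variation of a solution of the resolvent equation is, up to a total derivative, the
variation of the potential times a derivative with respect to the spectral parameter. -/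
theorem resolvent_variation (D δ E : Derivation ℝ A A) {z K G : A} (hG : IsUnit G)
    (hDz : D z = 0) (hδz : δ z = 0) (hEz : E z = 1) (hEK : E K = 0)
    (hδD : ∀ a, δ (D a) = D (δ a)) (hED : ∀ a, E (D a) = D (E a))
    (h : z * (2 * G * D (D G) - D G ^ 2 + 4 * K * G ^ 2) = 2 * G ^ 2 - 2) :
    ∃ W, δ G = z * δ K * (2 * (z * E G) + G) + z * D W := by
  have two : ∀ a : A, (2 : A) * a = 0 → a = 0 := fun a ha => by
    have : (2 : ℝ) • a = 0 := by rw [← ha, ← map_ofNat (algebraMap ℝ A) 2, Algebra.smul_def]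
    simpa using this
  -- Logarithmic variations `W₁ = δG / G` and `W₂ = z E G / G`. Both solve an equation with the same
  -- formally self-adjoint operator up to the factor `G`, `L W = -2 W + z G (G W')'`, with
  -- right-hand sides `-2 z δK G²` and `1 - G²`.
  obtain ⟨W₁, h₁⟩ := hG.dvd (a := δ G)
  obtain ⟨W₂, h₂⟩ := hG.dvd (a := z * E G)
  have e₁ : -2 * W₁ + z * (G * D (G * D W₁)) = -2 * z * δ K * G ^ 2 := by
    have h' := congrArg δ h
    simp only [D.leibniz, δ.leibniz, δ.leibniz_pow, map_add, map_sub, δ.map_ofNat_eq_zero,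
      hδz, hδD, h₁, smul_eq_mul, nsmul_eq_mul] at h'
    simp only [D.leibniz, smul_eq_mul]
    push_cast at h'
    refine sub_eq_zero.1 (two _ ?_)
    linear_combination h' - 2 * W₁ * h
  have e₂ : -2 * W₂ + z * (G * D (G * D W₂)) = 1 - G ^ 2 := by
    have d₁ : z * D (E G) = D (G * W₂) := by rw [← h₂]; simp [hDz]
    have d₂ : z * D (D (E G)) = D (D (G * W₂)) := by rw [← d₁]; simp [hDz]
    have h' := congrArg E h
    simp only [E.leibniz, E.leibniz_pow, map_add, map_sub, E.map_ofNat_eq_zero, hEz, hEK,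
      hED, smul_eq_mul, nsmul_eq_mul] at h'
    simp only [D.leibniz, map_add, smul_eq_mul] at d₁ d₂ ⊢
    push_cast at h'
    refine sub_eq_zero.1 (two _ ?_)
    linear_combination z * h' - (1 + 2 * W₂) * h - 2 * z * G * d₂ + 2 * z * D G * d₁
      - (2 * z * D (D G) + 8 * z * K * G - 4 * G) * h₂
  -- Lagrange's identity: `W₁ L W₂ - W₂ L W₁ = z G (G (W₁ W₂' - W₂ W₁'))'`. Subtracting `½ L W₁`
  -- removes the leftover `W₁`, and dividing by `G` gives the claim.
  refine ⟨-(G * (W₁ * D W₂ - W₂ * D W₁) - algebraMap ℝ A (1 / 2) * (G * D W₁)), ?_⟩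
  have half : 2 * algebraMap ℝ A (1 / 2) = 1 := by
    rw [← map_ofNat (algebraMap ℝ A) 2, ← map_mul]; norm_num
  refine hG.mul_left_cancel ?_
  simp only [D.leibniz, map_sub, map_neg, D.map_algebraMap, smul_eq_mul] at e₁ e₂ ⊢
  rw [h₁, h₂]
  linear_combination W₁ * e₂ - (W₂ + algebraMap ℝ A (1 / 2)) * e₁ + (z * δ K * G ^ 2 - W₁) * half

end Resolvent

/-! ### Sequences satisfying the quadratic Lenard recursion -/

section GradSequence

open PowerSeries Finset

variable {R : Type*} [CommRing R] [Algebra ℝ R]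

/-- The extension of a derivation to power series, acting on the coefficients. -/
noncomputable def coeffwise (D : Derivation ℝ R R) : Derivation ℝ R⟦X⟧ R⟦X⟧ :=
  Derivation.mk'
    { toFun := fun f => PowerSeries.mk fun n => D (coeff n f)
      map_add' := fun f g => by ext n; simp
      map_smul' := fun r f => by ext n; simp }
    fun f g => by
      ext n
      simp only [LinearMap.coe_mk, AddHom.coe_mk, coeff_mk, coeff_mul, map_sum, D.leibniz,
        smul_eq_mul, map_add, sum_add_distrib]
      congr 1
      rw [← Finset.Nat.sum_antidiagonal_swap]
      rfl

@[simp]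
theorem coeff_coeffwise (D : Derivation ℝ R R) (f : R⟦X⟧) (n : ℕ) :
    coeff n (coeffwise D f) = D (coeff n f) := by
  simp [coeffwise]

theorem coeffwise_C (D : Derivation ℝ R R) (a : R) : coeffwise D (C a) = C (D a) := by
  ext n
  rw [coeff_coeffwise, coeff_C, coeff_C]
  split_ifs <;> simp

theorem coeffwise_X (D : Derivation ℝ R R) : coeffwise D (X : R⟦X⟧) = 0 := by
  ext n
  rw [coeff_coeffwise, coeff_X]
  split_ifs <;> simp

/-- `g` solves the quadratic recursion that defines the gradients of the KdV hierarchy with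
potential `k`, in a ring with derivation `D`. -/
structure IsGradSequence (D : Derivation ℝ R R) (k : R) (g : ℕ → R) : Prop where
  zero : g 0 = 1
  succ : ∀ n, ∑ p ∈ antidiagonal n,
    (2 * g p.1 * D (D (g p.2)) - D (g p.1) * D (g p.2) + 4 * k * (g p.1 * g p.2)) =
      2 * ∑ p ∈ antidiagonal (n + 1), g p.1 * g p.2

namespace IsGradSequence

variable {D : Derivation ℝ R R} {k : R} {g : ℕ → R}

theorem isUnit_mk (h : IsGradSequence D k g) : IsUnit (PowerSeries.mk g) := by
  rw [isUnit_iff_constantCoeff, ← coeff_zero_eq_constantCoeff_apply, coeff_mk, h.zero]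
  exact isUnit_one

/-- The coefficient of `X^(n+1)` is `h.succ n`; the constant term vanishes because `g 0 = 1`. -/
theorem resolvent (h : IsGradSequence D k g) :
    (X : R⟦X⟧) * (2 * PowerSeries.mk g * coeffwise D (coeffwise D (PowerSeries.mk g))
      - coeffwise D (PowerSeries.mk g) ^ 2 + 4 * C k * PowerSeries.mk g ^ 2) =
      2 * PowerSeries.mk g ^ 2 - 2 := by
  have two : (2 : R⟦X⟧) = C 2 := (map_ofNat _ 2).symm
  have four : (4 : R⟦X⟧) = C 4 := (map_ofNat _ 4).symm
  ext n
  rw [two, four]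
  cases n with
  | zero =>
    rw [coeff_zero_X_mul]
    simp [pow_two, coeff_mul, h.zero, -coeff_zero_eq_constantCoeff]
  | succ n =>
    rw [coeff_succ_X_mul]
    simp only [map_add, map_sub, mul_assoc, coeff_C_mul, pow_two, coeff_succ_C, sub_zero]
    simp only [coeff_mul, coeff_mk, coeff_coeffwise, ← h.succ]
    simp only [sum_add_distrib, sum_sub_distrib, mul_sum, mul_assoc]

/-- The Lenard recursion `D g_{n+1} = (D³ / 2 + 2 k D + D k) g_n`. -/
theorem lenard (h : IsGradSequence D k g) (n : ℕ) :
    2 * D (g (n + 1)) = D (D (D (g n))) + 4 * k * D (g n) + 2 * D k * g n := by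
  have := congrArg (coeff (n + 1))
    (resolvent_lenard (coeffwise D) h.isUnit_mk (coeffwise_X D) h.resolvent)
  have two : (2 : R⟦X⟧) = C 2 := (map_ofNat _ 2).symm
  have four : (4 : R⟦X⟧) = C 4 := (map_ofNat _ 4).symm
  simpa only [two, four, coeff_succ_X_mul, map_add, mul_assoc, coeff_C_mul, coeff_mk,
    coeff_coeffwise, coeffwise_C] using this

/-- The variational derivative of `g_{n+1}` is `(2 n + 1) g_n`. -/
theorem variation (h : IsGradSequence D k g) (δ : Derivation ℝ R R)
    (hδ : ∀ a, δ (D a) = D (δ a)) (n : ℕ) :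
    ∃ w, δ (g (n + 1)) = (2 * n + 1) * δ k * g n + D w := by
  -- Here `E = d/dX`. The operator `2 X d/dX + 1` multiplies the `n`-th coefficient by `2 n + 1`,
  -- and the extra factor `X` shifts `n` to `n + 1`.
  obtain ⟨W, hW⟩ := resolvent_variation (coeffwise D) (coeffwise δ)
    ((PowerSeries.derivative R).restrictScalars ℝ) h.isUnit_mk (coeffwise_X D) (coeffwise_X δ)
    (by simp) (by simp) (fun f => by ext n; simp [hδ])
    (fun f => by
      ext n
      simp only [Derivation.restrictScalars_apply, coeff_derivative, coeff_coeffwise, D.leibniz,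
        smul_eq_mul, map_add, D.map_natCast, D.map_one_eq_zero]
      ring) h.resolvent
  refine ⟨coeff n W, ?_⟩
  have := congrArg (coeff (n + 1)) hW
  have two : (2 : R⟦X⟧) = C 2 := (map_ofNat _ 2).symm
  simp only [two, coeff_succ_X_mul, map_add, mul_assoc, coeff_C_mul, coeff_mk,
    coeff_coeffwise, coeffwise_C] at this
  rw [this]
  cases n with
  | zero => simp
  | succ n =>
    simp only [coeff_succ_X_mul, Derivation.restrictScalars_apply, coeff_derivative, coeff_mk]
    push_cast
    ring

/-- A homomorphism of differential rings preserves the recursion. -/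
theorem map (h : IsGradSequence D k g) {S : Type*} [CommRing S] [Algebra ℝ S]
    {D' : Derivation ℝ S S} (f : R →ₐ[ℝ] S) (hf : ∀ a, f (D a) = D' (f a)) :
    IsGradSequence D' (f k) fun n => f (g n) where
  zero := by simp [h.zero]
  succ n := by
    have := congrArg f (h.succ n)
    simpa only [map_sum, map_add, map_sub, map_mul, map_ofNat, hf] using this

end IsGradSequence

end GradSequence

namespace DiffPoly

open MvPolynomial Finset

theorem isGradSequence_grad : IsGradSequence D (X 0) grad where
  zero := by rw [grad]
  succ n := by
    have h := grad.eq_2 n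
    rw [Fin.sum_univ_eq_sum_range (fun i => C (1 / 2) * grad i * D (D (grad (n - i)))
        - C (1 / 4) * D (grad i) * D (grad (n - i)) + X 0 * grad i * grad (n - i)),
      Fin.sum_univ_eq_sum_range (fun i => grad (i + 1) * grad (n - i))] at h
    have h₄ : (4 : DiffPoly) * C (1 / 4) = 1 := by
      rw [← map_ofNat C 4, ← map_mul]; norm_num
    have h₂ : (2 : DiffPoly) * C (1 / 2) = 1 := by
      rw [← map_ofNat C 2, ← map_mul]; norm_num
    have e : (4 : DiffPoly) * ∑ i ∈ range (n + 1), (C (1 / 2) * grad i * D (D (grad (n - i)))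
        - C (1 / 4) * D (grad i) * D (grad (n - i)) + X 0 * grad i * grad (n - i)) =
        ∑ i ∈ range (n + 1), (2 * grad i * D (D (grad (n - i)))
        - D (grad i) * D (grad (n - i)) + 4 * X 0 * (grad i * grad (n - i))) := by
      rw [mul_sum]
      refine sum_congr rfl fun i _ => ?_
      linear_combination 2 * grad i * D (D (grad (n - i))) * h₂
        - D (grad i) * D (grad (n - i)) * h₄
    have g₀ : grad 0 = 1 := by rw [grad]
    -- The two end terms contain `g_0 = 1` and contribute `2 g_{n+1}`; this is what the definition
    -- of `grad` solves for.
    have e' : ∑ i ∈ range (n + 1).succ, grad i * grad (n + 1 - i) =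
        2 * grad (n + 1) + ∑ i ∈ range n, grad (i + 1) * grad (n - i) := by
      rw [sum_range_succ', sum_range_succ]
      simp only [Nat.sub_self, Nat.sub_zero, Nat.add_sub_add_right, g₀]
      ring
    rw [Finset.Nat.sum_antidiagonal_eq_sum_range_succ_mk,
      Finset.Nat.sum_antidiagonal_eq_sum_range_succ_mk, e']
    refine e.symm.trans ?_
    linear_combination (-4) * h + 2 * (∑ x ∈ range n, grad (x + 1) * grad (n - x)) * h₂

theorem D_grad_succ (n : ℕ) :
    2 * D (grad (n + 1)) = D (D (D (grad n))) + 4 * X 0 * D (grad n) + 2 * X 1 * grad n := by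
  have := isGradSequence_grad.lenard n
  rwa [show D (X 0) = X 1 from mkDerivation_X _ _ _] at this

/-- Differential polynomials in a function `κ` and a variation `u` of it; the variables `inl i`
and `inr i` stand for `D_s^i κ` and `D_s^i u`. -/
abbrev VarPoly : Type := MvPolynomial (ℕ ⊕ ℕ) ℝ

namespace VarPoly

/-- The total derivative. -/
noncomputable def D : Derivation ℝ VarPoly VarPoly :=
  mkDerivation ℝ fun j => X (j.map (· + 1) (· + 1))

/-- The variation: the derivation that sends `D_s^i κ` to `D_s^i u`. -/
noncomputable def δ : Derivation ℝ VarPoly VarPoly :=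
  mkDerivation ℝ (Sum.elim (fun i => X (Sum.inr i)) fun _ => 0)

/-- Differential polynomials in `κ` alone. -/
noncomputable def incl : DiffPoly →ₐ[ℝ] VarPoly := rename Sum.inl

theorem incl_D (p : DiffPoly) : incl (DiffPoly.D p) = D (incl p) := by
  induction p using MvPolynomial.induction_on with
  | C a => simp [incl, ← algebraMap_eq]
  | add p q hp hq => simp [hp, hq]
  | mul_X p i hp => 
    have : D (incl (X i)) = incl (DiffPoly.D (X i)) := by
      simp [incl, D, DiffPoly.D, mkDerivation_X]
    simp only [Derivation.leibniz, map_mul, smul_eq_mul, map_add, hp, this]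

/-- The commutator of two derivations is a derivation, so only generators matter; there both sides
shift the order by one. -/
theorem δ_D (p : VarPoly) : δ (D p) = D (δ p) := by
  induction p using MvPolynomial.induction_on with
  | C a => simp [← algebraMap_eq]
  | add p q hp hq => simp [hp, hq]
  | mul_X p i hp =>
    have : δ (D (X i)) = D (δ (X i)) := by
      cases i <;> simp [δ, D, mkDerivation_X]
    simp only [Derivation.leibniz, smul_eq_mul, map_add, hp, this]
    ring

/-- The recursion is transported along `incl` to a ring that also contains the variation `u`. -/
theorem δ_grad_succ (n : ℕ) : ∃ w : VarPoly,
    δ (incl (grad (n + 1))) = (2 * (n : VarPoly) + 1) * X (Sum.inr 0) * incl (grad n) + D w := by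
  have := (isGradSequence_grad.map incl incl_D).variation δ δ_D n
  rwa [show δ (incl (X 0)) = X (Sum.inr 0) by simp [incl, δ, mkDerivation_X]] at this

end VarPoly

end DiffPoly

/-! ### Smooth functions of two variables -/

section TwoVariables

variable {E : Type*} [NormedAddCommGroup E] [NormedSpace ℝ E] {F : ℝ → ℝ → E}

theorem hasDerivAt_fst_of_contDiff (hF : ContDiff ℝ ∞ fun p : ℝ × ℝ => F p.1 p.2) (t s : ℝ) :
    HasDerivAt (fun t => F t s) (fderiv ℝ (fun p : ℝ × ℝ => F p.1 p.2) (t, s) (1, 0)) t :=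
  HasFDerivAt.comp_hasDerivAt (f := fun t : ℝ => (t, s)) t
    (hF.differentiable (by simp) (t, s)).hasFDerivAt
    ((hasDerivAt_id t).prodMk (hasDerivAt_const t s))

theorem hasDerivAt_snd_of_contDiff (hF : ContDiff ℝ ∞ fun p : ℝ × ℝ => F p.1 p.2) (t s : ℝ) :
    HasDerivAt (F t) (fderiv ℝ (fun p : ℝ × ℝ => F p.1 p.2) (t, s) (0, 1)) s :=
  HasFDerivAt.comp_hasDerivAt (f := fun s : ℝ => (t, s)) s
    (hF.differentiable (by simp) (t, s)).hasFDerivAt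
    ((hasDerivAt_const s t).prodMk (hasDerivAt_id s))

theorem contDiff_fderiv_apply (hF : ContDiff ℝ ∞ fun p : ℝ × ℝ => F p.1 p.2) (v : ℝ × ℝ) :
    ContDiff ℝ ∞ fun p : ℝ × ℝ => fderiv ℝ (fun p : ℝ × ℝ => F p.1 p.2) p v :=
  (hF.fderiv_right (m := ∞) (by simp)).clm_apply contDiff_const

theorem contDiff_deriv_fst (hF : ContDiff ℝ ∞ fun p : ℝ × ℝ => F p.1 p.2) :
    ContDiff ℝ ∞ fun p : ℝ × ℝ => deriv (fun t => F t p.2) p.1 := by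
  simpa only [(hasDerivAt_fst_of_contDiff hF _ _).deriv] using contDiff_fderiv_apply hF (1, 0)

theorem contDiff_deriv_snd (hF : ContDiff ℝ ∞ fun p : ℝ × ℝ => F p.1 p.2) :
    ContDiff ℝ ∞ fun p : ℝ × ℝ => deriv (F p.1) p.2 := by
  simpa only [(hasDerivAt_snd_of_contDiff hF _ _).deriv] using contDiff_fderiv_apply hF (0, 1)

theorem deriv_deriv_comm (hF : ContDiff ℝ ∞ fun p : ℝ × ℝ => F p.1 p.2) (t s : ℝ) :
    deriv (fun t => deriv (F t) s) t = deriv (fun s => deriv (fun t => F t s) t) s := by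
  simp only [(hasDerivAt_snd_of_contDiff hF _ _).deriv, (hasDerivAt_fst_of_contDiff hF _ _).deriv]
  have hd : DifferentiableAt ℝ (fderiv ℝ fun p : ℝ × ℝ => F p.1 p.2) (t, s) :=
    (hF.fderiv_right (m := ∞) (by simp)).differentiable (by simp) _
  rw [(hasDerivAt_fst_of_contDiff (F := fun t s => fderiv ℝ (fun p : ℝ × ℝ => F p.1 p.2) (t, s) (0, 1))
      (contDiff_fderiv_apply hF (0, 1)) t s).deriv,
    (hasDerivAt_snd_of_contDiff (F := fun t s => fderiv ℝ (fun p : ℝ × ℝ => F p.1 p.2) (t, s) (1, 0))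
      (contDiff_fderiv_apply hF (1, 0)) t s).deriv]
  simp only [Prod.mk.eta]
  rw [fderiv_clm_apply hd (differentiableAt_const _), fderiv_clm_apply hd (differentiableAt_const _)]
  have : IsSymmSndFDerivAt ℝ (fun p : ℝ × ℝ => F p.1 p.2) (t, s) :=
    hF.contDiffAt.isSymmSndFDerivAt (by
      rw [minSmoothness_of_isRCLikeNormedField]
      exact WithTop.coe_le_coe.2 le_top)
  simpa using this (1, 0) (0, 1)

theorem contDiff_iteratedDeriv_snd (hF : ContDiff ℝ ∞ fun p : ℝ × ℝ => F p.1 p.2) (i : ℕ) :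
    ContDiff ℝ ∞ fun p : ℝ × ℝ => iteratedDeriv i (F p.1) p.2 := by
  induction i with
  | zero => simpa using hF
  | succ i ih =>
    simp only [iteratedDeriv_succ]
    exact contDiff_deriv_snd (F := fun t => iteratedDeriv i (F t)) ih

theorem deriv_iteratedDeriv_comm (hF : ContDiff ℝ ∞ fun p : ℝ × ℝ => F p.1 p.2) (i : ℕ) (t : ℝ) :
    (fun s => deriv (fun t => iteratedDeriv i (F t) s) t) =
      iteratedDeriv i fun s => deriv (fun t => F t s) t := by
  induction i with
  | zero => simp
  | succ i ih =>
    simp only [iteratedDeriv_succ, ← ih]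
    ext s
    exact deriv_deriv_comm (F := fun t => iteratedDeriv i (F t)) (contDiff_iteratedDeriv_snd hF i) t s

theorem hasDerivAt_iteratedDeriv (hF : ContDiff ℝ ∞ fun p : ℝ × ℝ => F p.1 p.2) (i : ℕ)
    (t s : ℝ) : HasDerivAt (fun t => iteratedDeriv i (F t) s)
      (iteratedDeriv i (fun s => deriv (fun t => F t s) t) s) t := by
  rw [← deriv_iteratedDeriv_comm hF]
  exact (hasDerivAt_fst_of_contDiff (F := fun t => iteratedDeriv i (F t))
    (contDiff_iteratedDeriv_snd hF i) t s).differentiableAt.hasDerivAt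

theorem hasDerivAt_integral_of_contDiff (hF : ContDiff ℝ ∞ fun p : ℝ × ℝ => F p.1 p.2)
    (a b t : ℝ) : HasDerivAt (fun t => ∫ s in a..b, F t s)
      (∫ s in a..b, deriv (fun t => F t s) t) t := by
  have hc : ∀ t, Continuous (F t) := fun t => hF.continuous.comp (by fun_prop : Continuous fun s : ℝ => (t, s))
  have hF' := (contDiff_deriv_fst hF).continuous
  obtain ⟨B, hB⟩ := ((isCompact_closedBall t 1).prod (isCompact_uIcc (a := a) (b := b))).exists_bound_of_continuousOn
    hF'.continuousOn
  refine (intervalIntegral.hasDerivAt_integral_of_dominated_loc_of_deriv_le (bound := fun _ => B)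
    (F' := fun t s => deriv (fun t => F t s) t)
    (Metric.closedBall_mem_nhds t one_pos) (.of_forall fun x => (hc x).aestronglyMeasurable)
    ((hc t).intervalIntegrable _ _)
    (hF'.comp (by fun_prop : Continuous fun s : ℝ => (t, s))).aestronglyMeasurable
    (.of_forall fun s hs x hx => hB (x, s) ⟨hx, Set.uIoc_subset_uIcc hs⟩)
    intervalIntegrable_const (.of_forall fun s _ x _ => ?_)).2
  exact (hasDerivAt_fst_of_contDiff hF x s).differentiableAt.hasDerivAt

end TwoVariables

/-! ### Functions on the circle -/

namespace IsCircleFun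

variable {f g : ℝ → ℝ}

theorem deriv (hf : IsCircleFun f) : IsCircleFun (deriv f) where
  smooth := (contDiff_infty_iff_deriv.1 hf.smooth).2
  periodic s := by
    rw [← deriv_comp_add_const]
    exact congrArg (fun h => _root_.deriv h s) (funext hf.periodic)

theorem iteratedDeriv (hf : IsCircleFun f) (i : ℕ) : IsCircleFun (iteratedDeriv i f) := by
  induction i with
  | zero => simpa using hf
  | succ i ih => rw [iteratedDeriv_succ]; exact ih.deriv

theorem const (c : ℝ) : IsCircleFun fun _ => c := ⟨contDiff_const, fun _ => rfl⟩

theorem add (hf : IsCircleFun f) (hg : IsCircleFun g) : IsCircleFun fun s => f s + g s :=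
  ⟨hf.smooth.add hg.smooth, hf.periodic.add hg.periodic⟩

theorem sub (hf : IsCircleFun f) (hg : IsCircleFun g) : IsCircleFun fun s => f s - g s :=
  ⟨hf.smooth.sub hg.smooth, hf.periodic.sub hg.periodic⟩

theorem mul (hf : IsCircleFun f) (hg : IsCircleFun g) : IsCircleFun fun s => f s * g s :=
  ⟨hf.smooth.mul hg.smooth, hf.periodic.mul hg.periodic⟩

theorem hasDerivAt (hf : IsCircleFun f) (s : ℝ) : HasDerivAt f (_root_.deriv f s) s :=
  (hf.smooth.differentiable (by simp) s).hasDerivAt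

theorem intervalIntegrable (hf : IsCircleFun f) (a b : ℝ) :
    IntervalIntegrable f MeasureTheory.volume a b :=
  hf.smooth.continuous.intervalIntegrable a b

/-- The integral of a derivative over the circle vanishes. -/
theorem integral_eq_zero_of_hasDerivAt (hg : IsCircleFun g) (hf : IsCircleFun f)
    (h : ∀ s, HasDerivAt g (f s) s) : ∫ s in (0 : ℝ)..(2 * Real.pi), f s = 0 := by
  rw [intervalIntegral.integral_eq_sub_of_hasDerivAt (fun s _ => h s) (hf.intervalIntegrable _ _)]
  simpa using sub_eq_zero.2 (hg.periodic 0)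

/-- A function of mean zero on the circle has a primitive on the circle. -/
theorem exists_primitive (hf : IsCircleFun f) (h : ∫ s in (0 : ℝ)..(2 * Real.pi), f s = 0) :
    ∃ p, IsCircleFun p ∧ _root_.deriv p = f := by
  have hd : ∀ s, HasDerivAt (fun s => ∫ x in (0 : ℝ)..s, f x) (f s) s := fun s =>
    hf.smooth.continuous.integral_hasStrictDerivAt 0 s |>.hasDerivAt
  have hd' : _root_.deriv (fun s => ∫ x in (0 : ℝ)..s, f x) = f := funext fun s => (hd s).deriv
  refine ⟨_, ⟨contDiff_infty_iff_deriv.2 ⟨fun s => (hd s).differentiableAt, ?_⟩, fun s => ?_⟩, hd'⟩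
  · rw [hd']; exact hf.smooth
  -- The increment of the primitive over any period is the integral over `[0, 2π]`, which is zero.
  · have := hf.periodic.intervalIntegral_add_eq s 0
    rw [zero_add, h] at this
    rw [← intervalIntegral.integral_add_adjacent_intervals (hf.intervalIntegrable 0 s)
      (hf.intervalIntegrable s _), this, add_zero]

theorem omega {κ p : ℝ → ℝ} (hκ : IsCircleFun κ) (hf : IsCircleFun f) (hp : IsCircleFun p) :
    IsCircleFun (omega κ f p) :=
  (((const (1 / 2)).mul hf.deriv.deriv).add (((const 2).mul hκ).mul hf)).add (hκ.deriv.mul hp)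

end IsCircleFun

/-! ### Evaluation of differential polynomials -/

namespace DiffPoly

open MvPolynomial

namespace VarPoly

/-- The value of a differential polynomial on a function `κ` and a variation `u`. -/
noncomputable def evalAt (κ u : ℝ → ℝ) (s : ℝ) : VarPoly →ₐ[ℝ] ℝ :=
  aeval (Sum.elim (fun i => iteratedDeriv i κ s) fun i => iteratedDeriv i u s)

variable {κ u : ℝ → ℝ}

theorem evalAt_incl (s : ℝ) (p : DiffPoly) :
    evalAt κ u s (incl p) = DiffPoly.evalAt κ s p := by
  rw [evalAt, incl, aeval_rename]
  rfl

theorem evalAt_inr (s : ℝ) : evalAt κ u s (X (Sum.inr 0)) = u s := by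
  simp [evalAt]

theorem isCircleFun_evalAt (hκ : IsCircleFun κ) (hu : IsCircleFun u) (p : VarPoly) :
    IsCircleFun fun s => evalAt κ u s p := by
  induction p using MvPolynomial.induction_on with
  | C a => simpa [evalAt] using IsCircleFun.const a
  | add p q hp hq => simpa only [map_add] using hp.add hq
  | mul_X p i hp =>
    simp only [map_mul]
    refine hp.mul ?_
    cases i with
    | inl i => simpa [evalAt] using hκ.iteratedDeriv i
    | inr i => simpa [evalAt] using hu.iteratedDeriv i

theorem hasDerivAt_evalAt (hκ : IsCircleFun κ) (hu : IsCircleFun u) (p : VarPoly) (s : ℝ) :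
    HasDerivAt (fun s => evalAt κ u s p) (evalAt κ u s (D p)) s := by
  induction p using MvPolynomial.induction_on with
  | C a =>
    simpa [evalAt, ← algebraMap_eq] using hasDerivAt_const s a
  | add p q hp hq =>
    simp only [map_add]
    exact hp.add hq
  | mul_X p i hp =>
    have hi : HasDerivAt (fun s => evalAt κ u s (X i)) (evalAt κ u s (D (X i))) s := by
      cases i with
      | inl i =>
        simpa [evalAt, D, mkDerivation_X, iteratedDeriv_succ] using (hκ.iteratedDeriv i).hasDerivAt s
      | inr i =>
        simpa [evalAt, D, mkDerivation_X, iteratedDeriv_succ] using (hu.iteratedDeriv i).hasDerivAt s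
    simp only [map_mul, Derivation.leibniz, smul_eq_mul, map_add]
    exact (hp.mul hi).congr_deriv (by ring)

theorem integral_evalAt_D (hκ : IsCircleFun κ) (hu : IsCircleFun u) (p : VarPoly) :
    ∫ s in (0 : ℝ)..(2 * Real.pi), evalAt κ u s (D p) = 0 :=
  (isCircleFun_evalAt hκ hu p).integral_eq_zero_of_hasDerivAt (isCircleFun_evalAt hκ hu _)
    (hasDerivAt_evalAt hκ hu p)

end VarPoly

/-- The variation plays no role for polynomials in `κ` alone, so `u = 0` is inserted. -/
theorem isCircleFun_evalAt {κ : ℝ → ℝ} (hκ : IsCircleFun κ) (p : DiffPoly) :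
    IsCircleFun fun s => evalAt κ s p := by
  simpa only [VarPoly.evalAt_incl] using
    VarPoly.isCircleFun_evalAt hκ (IsCircleFun.const 0) (VarPoly.incl p)

theorem hasDerivAt_evalAt {κ : ℝ → ℝ} (hκ : IsCircleFun κ) (p : DiffPoly) (s : ℝ) :
    HasDerivAt (fun s => evalAt κ s p) (evalAt κ s (D p)) s := by
  simpa only [VarPoly.evalAt_incl, ← VarPoly.incl_D] using
    VarPoly.hasDerivAt_evalAt hκ (IsCircleFun.const 0) (VarPoly.incl p) s

section Family

variable {K : ℝ → ℝ → ℝ}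

theorem contDiff_evalAt_family (hK : ContDiff ℝ ∞ fun p : ℝ × ℝ => K p.1 p.2) (p : DiffPoly) :
    ContDiff ℝ ∞ fun q : ℝ × ℝ => evalAt (K q.1) q.2 p := by
  unfold evalAt
  induction p using MvPolynomial.induction_on with
  | C a => simpa using contDiff_const
  | add p q hp hq => simpa only [map_add] using hp.add hq
  | mul_X p i hp =>
    simp only [map_mul, aeval_X]
    exact hp.mul (contDiff_iteratedDeriv_snd hK i)

/-- The chain rule: since `∂_t` commutes with `D_s^i`, the time derivative is the formal variation
`δ` evaluated at `u = κ_t`. -/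
theorem hasDerivAt_evalAt_family (hK : ContDiff ℝ ∞ fun p : ℝ × ℝ => K p.1 p.2) (p : DiffPoly)
    (t s : ℝ) : HasDerivAt (fun t => evalAt (K t) s p)
      (VarPoly.evalAt (K t) (fun s => deriv (fun t => K t s) t) s (VarPoly.δ (VarPoly.incl p))) t := by
  induction p using MvPolynomial.induction_on with
  | C a =>
    simpa [evalAt, VarPoly.incl, ← algebraMap_eq] using hasDerivAt_const t a
  | add p q hp hq =>
    simp only [evalAt, map_add] at hp hq ⊢
    exact hp.add hq
  | mul_X p i hp =>
    have hi : HasDerivAt (fun t => evalAt (K t) s (X i))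
        (VarPoly.evalAt (K t) (fun s => deriv (fun t => K t s) t) s
          (VarPoly.δ (VarPoly.incl (X i)))) t := by
      simpa [evalAt, VarPoly.evalAt, VarPoly.incl, VarPoly.δ, mkDerivation_X] using
        hasDerivAt_iteratedDeriv hK i t s
    have := hp.mul hi
    rw [← VarPoly.evalAt_incl (u := fun s => deriv (fun t => K t s) t),
      ← VarPoly.evalAt_incl (u := fun s => deriv (fun t => K t s) t)] at this
    simp only [map_mul, Derivation.leibniz, smul_eq_mul, map_add]
    refine (this.congr_deriv (by ring)).congr_of_eventuallyEq (.of_forall fun x => ?_)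
    simp [evalAt]

/-- The first variation of `∫ h_{n+1} ds` is `∫ g_n u ds`. -/
theorem hasDerivAt_integral_density (hK : ContDiff ℝ ∞ fun p : ℝ × ℝ => K p.1 p.2)
    (hper : ∀ t, Function.Periodic (K t) (2 * Real.pi)) (n : ℕ) (t : ℝ) :
    HasDerivAt (fun t => ∫ s in (0 : ℝ)..(2 * Real.pi), evalAt (K t) s (density (n + 1)))
      (∫ s in (0 : ℝ)..(2 * Real.pi), evalAt (K t) s (grad n) * deriv (fun t => K t s) t) t := by
  refine (hasDerivAt_integral_of_contDiff (contDiff_evalAt_family hK _) _ _ t).congr_deriv ?_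
  simp only [(hasDerivAt_evalAt_family hK _ _ _).deriv]
  have hκ : IsCircleFun (K t) := ⟨hK.comp (f := fun s : ℝ => (t, s)) (by fun_prop), hper t⟩
  have hu : IsCircleFun fun s => deriv (fun t => K t s) t :=
    ⟨(contDiff_deriv_fst hK).comp (f := fun s : ℝ => (t, s)) (by fun_prop),
      fun s => by simp only [hper _ s]⟩
  set u : ℝ → ℝ := fun s => deriv (fun t => K t s) t
  -- The factor `2 n + 1` cancels the normalization `2 (n + 1) - 1` of the density, and `D w`
  -- integrates to zero.
  obtain ⟨w, hw⟩ := VarPoly.δ_grad_succ n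
  have e : ∀ s, VarPoly.evalAt (K t) u s (VarPoly.δ (VarPoly.incl (density (n + 1)))) =
      evalAt (K t) s (grad n) * u s +
        1 / (2 * (n : ℝ) + 1) * VarPoly.evalAt (K t) u s (VarPoly.D w) := fun s => by
    have hn : 2 * (n : ℝ) + 1 ≠ 0 := by positivity
    have : density (n + 1) = (1 / (2 * (n : ℝ) + 1)) • grad (n + 1) := by
      rw [density, smul_eq_C_mul]; push_cast; ring_nf
    rw [this, map_smul, VarPoly.δ.map_smul, hw, map_smul, map_add, map_mul, map_mul, map_add, map_mul,
      map_natCast, map_ofNat, map_one, VarPoly.evalAt_inr, VarPoly.evalAt_incl, smul_eq_mul]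
    field_simp
  simp only [e]
  rw [intervalIntegral.integral_add (((isCircleFun_evalAt hκ _).mul hu).intervalIntegrable _ _)
    (((IsCircleFun.const _).mul (VarPoly.isCircleFun_evalAt hκ hu _)).intervalIntegrable _ _),
    intervalIntegral.integral_const_mul, VarPoly.integral_evalAt_D hκ hu, mul_zero, add_zero]

end Family

/-- The Lenard recursion, evaluated and integrated against a derivative: the operator
`D_s³ / 2 + 2 κ D_s + κ_s` is skew-symmetric. -/
theorem integral_grad_mul_omega {κ p : ℝ → ℝ} (hκ : IsCircleFun κ) (hp : IsCircleFun p) (n : ℕ) :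
    ∫ s in (0 : ℝ)..(2 * Real.pi), evalAt κ s (grad n) * omega κ (deriv p) p s =
      ∫ s in (0 : ℝ)..(2 * Real.pi), evalAt κ s (grad (n + 1)) * deriv p s := by
  have c := isCircleFun_evalAt hκ
  have h := hasDerivAt_evalAt hκ
  rw [← sub_eq_zero, ← intervalIntegral.integral_sub
    (((c _).mul (hκ.omega hp.deriv hp)).intervalIntegrable _ _)
    (((c _).mul hp.deriv).intervalIntegrable _ _)]
  set g := grad n
  -- The boundary terms from integrating `g_n P p` by parts, minus `g_{n+1} p`; the terms left over
  -- in the derivative are `p` times the Lenard recursion.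
  refine IsCircleFun.integral_eq_zero_of_hasDerivAt
    (g := fun s => 1 / 2 * (evalAt κ s g * deriv (deriv p) s - evalAt κ s (D g) * deriv p s
      + evalAt κ s (D (D g)) * p s) + 2 * κ s * (evalAt κ s g * p s)
      - evalAt κ s (grad (n + 1)) * p s)
    ((((IsCircleFun.const _).mul ((((c _).mul hp.deriv.deriv).sub ((c _).mul hp.deriv)).add
      ((c _).mul hp))).add (((IsCircleFun.const _).mul hκ).mul ((c _).mul hp))).sub ((c _).mul hp))
    (((c _).mul (hκ.omega hp.deriv hp)).sub ((c _).mul hp.deriv)) fun s => ?_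
  have d₀ := hp.hasDerivAt s
  have d₁ := hp.deriv.hasDerivAt s
  have d₂ := hp.deriv.deriv.hasDerivAt s
  have lenard : 2 * evalAt κ s (D (grad (n + 1))) = evalAt κ s (D (D (D g))) +
      4 * κ s * evalAt κ s (D g) + 2 * deriv κ s * evalAt κ s g := by
    have := congrArg (evalAt κ s) (D_grad_succ n)
    simpa [evalAt] using this
  refine (((((((h g s).mul d₂).sub ((h (D g) s).mul d₁)).add ((h (D (D g)) s).mul d₀)).const_mul
    (1 / 2)).add (((hκ.hasDerivAt s).const_mul 2).mul ((h g s).mul d₀))).sub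
    ((h (grad (n + 1)) s).mul d₀)).congr_deriv ?_
  simp only [omega, Pi.mul_apply]
  linear_combination (-1 / 2) * p s * lenard

end DiffPoly

/-! ### Motions of equicentroaffine curves -/

theorem det₂_eq (v w : Fin 2 → ℝ) : det₂ v w = v 0 * w 1 - v 1 * w 0 := by
  simp [det₂, Matrix.det_fin_two]

/-- The curvature of a smooth family of curves is jointly smooth. -/
theorem contDiff_curvature_family {Γ : ℝ → ℝ → Fin 2 → ℝ}
    (hΓ : ContDiff ℝ ∞ fun p : ℝ × ℝ => Γ p.1 p.2) :
    ContDiff ℝ ∞ fun p : ℝ × ℝ => curvature (Γ p.1) p.2 := by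
  have h₁ := contDiff_deriv_snd hΓ
  have h₂ := contDiff_deriv_snd (F := fun t => deriv (Γ t)) h₁
  simp only [curvature, det₂_eq]
  rw [contDiff_pi] at h₁ h₂
  exact ((h₁ 0).mul (h₂ 1)).sub ((h₁ 1).mul (h₂ 0))

theorem IsCurve.curvature_isCircleFun {γ : ℝ → Fin 2 → ℝ} (hγ : IsCurve γ) :
    IsCircleFun (curvature γ) where
  smooth := (contDiff_curvature_family (Γ := fun _ => γ) (hγ.smooth.comp contDiff_snd)).comp
    (f := fun s : ℝ => ((0 : ℝ), s)) (by fun_prop)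
  periodic s := by
    have h₁ : Function.Periodic (deriv γ) (2 * Real.pi) := fun s => by
      rw [← deriv_comp_add_const]
      exact congrArg (fun h => deriv h s) (funext hγ.periodic)
    have h₂ : Function.Periodic (deriv (deriv γ)) (2 * Real.pi) := fun s => by
      rw [← deriv_comp_add_const]
      exact congrArg (fun h => deriv h s) (funext h₁)
    simp only [curvature, h₁ s, h₂ s]

/-- The derivative of a field that is expressed in the frame `γ, γ_s`. -/
theorem IsCurve.hasDerivAt_frame {γ : ℝ → Fin 2 → ℝ} (hγ : IsCurve γ) {a b : ℝ → ℝ} {a' b' s : ℝ}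
    (ha : HasDerivAt a a' s) (hb : HasDerivAt b b' s) :
    HasDerivAt (fun s => a s • γ s + b s • deriv γ s)
      ((a' - curvature γ s * b s) • γ s + (a s + b') • deriv γ s) s := by
  have h₁ : HasDerivAt γ (deriv γ s) s := (hγ.smooth.differentiable (by simp) s).hasDerivAt
  have h₂ : HasDerivAt (deriv γ) (-(curvature γ s) • γ s) s := by
    rw [← deriv_deriv_eq hγ]
    exact ((contDiff_infty_iff_deriv.1 hγ.smooth).2.differentiable (by simp) s).hasDerivAt
  refine ((ha.smul h₁).add (hb.smul h₂)).congr_deriv ?_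
  module

/-- To be compared with the time derivative of `γ_ss = -κ γ`, which is `X_ss = -κ_t γ - κ X`; the
coefficient of `γ` then reveals `κ_t`. -/
theorem IsCurve.deriv_deriv_fieldOf {γ : ℝ → Fin 2 → ℝ} (hγ : IsCurve γ) {α : ℝ → ℝ}
    (hα : IsCircleFun α) (s : ℝ) :
    deriv (deriv (fieldOf γ α)) s =
      (-(omega (curvature γ) (deriv α) α s)) • γ s - curvature γ s • fieldOf γ α s := by
  have hκ := hγ.curvature_isCircleFun
  have h₁ : deriv (fieldOf γ α) = fun s =>
      (-(1 / 2) * deriv (deriv α) s - curvature γ s * α s) • γ s +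
        (-(1 / 2) * deriv α s + deriv α s) • deriv γ s :=
    funext fun s =>
      (hγ.hasDerivAt_frame ((hα.deriv.hasDerivAt s).const_mul _) (hα.hasDerivAt s)).deriv
  rw [h₁]
  refine (hγ.hasDerivAt_frame (((hα.deriv.deriv.hasDerivAt s).const_mul _).sub
    ((hκ.hasDerivAt s).mul (hα.hasDerivAt s))) (((hα.deriv.hasDerivAt s).const_mul _).add
    (hα.deriv.hasDerivAt s))).deriv.trans ?_
  simp only [fieldOf, omega, Pi.sub_apply, Pi.add_apply, Pi.mul_apply]
  module

/-- Along a motion with initial velocity `-½ α_s γ + α γ_s` one has `κ_t = Ω α_s`. -/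
theorem IsMotion.deriv_curvature {γ : ℝ → Fin 2 → ℝ} {α : ℝ → ℝ} {Γ : ℝ → ℝ → Fin 2 → ℝ}
    (h : IsMotion γ (fieldOf γ α) Γ) (hα : IsCircleFun α) (s : ℝ) :
    deriv (fun t => curvature (Γ t) s) 0 = omega (curvature γ) (deriv α) α s := by
  have hγ : IsCurve γ := h.start ▸ h.isCurve 0
  have hs₁ := contDiff_deriv_snd h.smooth
  have hX : (fun s => deriv (fun t => Γ t s) 0) = fieldOf γ α := funext h.velocity
  have e₁ : deriv (fun t => deriv (deriv (Γ t)) s) 0 = deriv (deriv (fieldOf γ α)) s := by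
    rw [deriv_deriv_comm (F := fun t => deriv (Γ t)) hs₁]
    simp only [deriv_deriv_comm h.smooth, hX]
  have hκ := (hasDerivAt_fst_of_contDiff (F := fun t s => curvature (Γ t) s)
    (contDiff_curvature_family h.smooth) 0 s).differentiableAt.hasDerivAt
  have hΓ := (hasDerivAt_fst_of_contDiff h.smooth 0 s).differentiableAt.hasDerivAt
  have e₂ := (hκ.neg.smul hΓ).deriv
  rw [h.velocity] at e₂
  have e₃ : (fun t => deriv (deriv (Γ t)) s) = (-fun t => curvature (Γ t) s) • fun t => Γ t s :=
    funext fun t => deriv_deriv_eq (h.isCurve t) s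
  rw [e₃, e₂, hγ.deriv_deriv_fieldOf hα] at e₁
  simp only [h.start, Pi.neg_apply] at e₁
  have e₄ : (deriv (fun t => curvature (Γ t) s) 0 - omega (curvature γ) (deriv α) α s) • γ s = 0 := by
    linear_combination (norm := module) (-1 : ℝ) • e₁
  exact sub_eq_zero.1 ((smul_eq_zero.1 e₄).resolve_right (hγ.ne_zero s))

/-- The gradients `g_0, …, g_{m-1}` are orthogonal to `Ω α_s` if `-½ α_s γ + α γ_s` is tangent to
the joint level set of `H_1, …, H_m`. -/
theorem integral_grad_mul_omega_eq_zero {m : ℕ} {γ : ℝ → Fin 2 → ℝ} {α : ℝ → ℝ}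
    (hα : IsCircleFun α) (hX : fieldOf γ α ∈ tangentSpace m γ) {j : ℕ} (hj : j + 1 ≤ m) :
    ∫ s in (0 : ℝ)..(2 * Real.pi), DiffPoly.evalAt (curvature γ) s (DiffPoly.grad j) *
      omega (curvature γ) (deriv α) α s = 0 := by
  obtain ⟨Γ, hΓ, hH⟩ := hX
  -- Two values for the derivative of `H_{j+1}` at time `0`: `∫ g_j κ_t` by the variation formula
  -- and `0` by tangency.
  have := (DiffPoly.hasDerivAt_integral_density (K := fun t => curvature (Γ t))
    (contDiff_curvature_family hΓ.smooth)
    (fun t => (hΓ.isCurve t).curvature_isCircleFun.periodic) j 0).unique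
    (hH (j + 1) (by omega) hj)
  simpa only [hΓ.deriv_curvature hα, hΓ.start] using this

/-! ### Powers of the recursion operator -/

theorem IsOmegaPower.isCircleFun {κ α f : ℝ → ℝ} {k : ℕ} (hκ : IsCircleFun κ)
    (hα : IsCircleFun α) (h : IsOmegaPower κ α k f) : IsCircleFun f := by
  induction h with
  | one => exact hκ.omega hα.deriv hα
  | succ _ hp hpf _ => exact hκ.omega (hpf ▸ hp.deriv) hp

/-- Each factor `Ω` can be traded for one step up in the index of the gradient, so `j + k` is
preserved; hence the induction keeps `j` general. -/
theorem IsOmegaPower.integral_grad_mul {κ α f : ℝ → ℝ} {m k : ℕ} (hκ : IsCircleFun κ)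
    (h₁ : ∀ j, j + 1 ≤ m → ∫ s in (0 : ℝ)..(2 * Real.pi),
      DiffPoly.evalAt κ s (DiffPoly.grad j) * omega κ (deriv α) α s = 0)
    (h : IsOmegaPower κ α k f) : ∀ j, j + k ≤ m →
      ∫ s in (0 : ℝ)..(2 * Real.pi), DiffPoly.evalAt κ s (DiffPoly.grad j) * f s = 0 := by
  induction h with
  | one => exact h₁
  | succ _ hp hpf ih =>
    intro j hj
    subst hpf
    rw [DiffPoly.integral_grad_mul_omega hκ hp]
    exact ih (j + 1) (by omega)

theorem IsOmegaPower.integral_eq_zero {κ α f : ℝ → ℝ} {m k : ℕ} (hκ : IsCircleFun κ)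
    (h₁ : ∀ j, j + 1 ≤ m → ∫ s in (0 : ℝ)..(2 * Real.pi),
      DiffPoly.evalAt κ s (DiffPoly.grad j) * omega κ (deriv α) α s = 0)
    (h : IsOmegaPower κ α k f) (hk : k ≤ m) : ∫ s in (0 : ℝ)..(2 * Real.pi), f s = 0 := by
  simpa [DiffPoly.evalAt, DiffPoly.grad] using h.integral_grad_mul hκ h₁ 0 (by omega)

end CentroAffine

theorem proposition3p2 (c : ℕ → ℝ) (m : ℕ) (hm : 1 ≤ m) (γ : ℝ → Fin 2 → ℝ)
    (hγ : γ ∈ CentroAffine.levelSet c m) (α : ℝ → ℝ) (hα : CentroAffine.IsCircleFun α)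
    (hX : CentroAffine.fieldOf γ α ∈ CentroAffine.tangentSpace m γ) :
    (∀ k, 1 ≤ k → k ≤ m + 1 →
      (∃ f, CentroAffine.IsOmegaPower (CentroAffine.curvature γ) α k f) ∧
      ∀ f, CentroAffine.IsOmegaPower (CentroAffine.curvature γ) α k f →
        CentroAffine.IsCircleFun f) ∧
    (∀ k, 1 ≤ k → k ≤ m →
      ∀ f, CentroAffine.IsOmegaPower (CentroAffine.curvature γ) α k f →
        (∃ p, CentroAffine.IsCircleFun p ∧ deriv p = f) ∧
        ∫ s in (0 : ℝ)..(2 * Real.pi), f s = 0) := by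
  have hκ := hγ.1.curvature_isCircleFun
  have h₁ : ∀ j, j + 1 ≤ m → _ := fun j hj =>
    CentroAffine.integral_grad_mul_omega_eq_zero hα hX hj
  have h₂ : ∀ k, 1 ≤ k → k ≤ m →
      ∀ f, CentroAffine.IsOmegaPower (CentroAffine.curvature γ) α k f →
        (∃ p, CentroAffine.IsCircleFun p ∧ deriv p = f) ∧
        ∫ s in (0 : ℝ)..(2 * Real.pi), f s = 0 := fun k _ hk f hf =>
    have h := hf.integral_eq_zero hκ h₁ hk
    ⟨(hf.isCircleFun hκ hα).exists_primitive h, h⟩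
  refine ⟨fun k hk hkm => ⟨?_, fun f hf => hf.isCircleFun hκ hα⟩, h₂⟩
  -- Forming the power `k + 1` needs a primitive only of the power `k ≤ m`, so existence reaches `m
  -- + 1`.
  induction k, hk using Nat.le_induction with
  | base => exact ⟨_, .one⟩
  | succ k hk ih =>
    obtain ⟨f, hf⟩ := ih (by omega)
    obtain ⟨p, hp, hpf⟩ := (h₂ k hk (by omega) f hf).1
    exact ⟨_, hf.succ hp hpf⟩
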